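/- Let $k$ be a natural number and let $\mathcal E\subset\mathbb C^{\mathbb Z^k}$ be a Banach space of complex sequences on $\mathbb Z^k$ which contains the space $F(\mathbb Z^k)$ of finitely supported sequences and satisfies: (h1) $F(\mathbb Z^k)$ is dense in $\mathcal E$; (h2) for every $n\in\mathbb Z^k$ the coordinate map $\mathcal E\ni x\mapsto x(n)\in\mathbb C$ is continuous; (h3) for every $z\in\mathbb T^k$ the map $\psi_z$, $(\psi_z x)(n)=x(n)z_1^{n_1}\cdots z_k^{n_k}$, maps $\mathcal E$ into $\mathcal E$, and $\sup_{z\in\mathbb T^k}\|\psi_z\|<\infty$. Assume moreover that all translations $x\mapsto x(\cdot-m)$, $m\in\mathbb Z^k$, map $\mathcal E$ into $\mathcal E$ (they are then bounded by the closed graph theorem). Write $z^n=z_1^{n_1}\cdots z_k^{n_k}$. For $\phi\in F(\mathbb Z^k)$ let $M_\phi f=\phi*f$ on $\mathcal E$ and $\tilde\phi(z)=\sum_n\phi(n)z^n$, and put $$\mathbb Z^k_{\mathcal E}=\{z\in(\mathbb C\setminus\{0\})^k:\ |\tilde\phi(z)|\le\|M_\phi\|\ \text{ for all }\phi\in F(\mathbb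 Z^k)\}.$$ For a bounded operator $M$ on $\mathcal E$ let $\widehat M=M(e_0)$, where $e_0(0)=1$ and $e_0(n)=0$ for $n\neq0$, let $\widetilde M(z)=\sum_{n\in\mathbb Z^k}\widehat M(n)z^n$ wherever this series converges absolutely, and let $\sigma(M)$ be the spectrum of $M$. Let $\mathcal A$ be the closure, in the operator norm, of the algebra generated by the operators $M_\phi$, $\phi\in F(\mathbb Z^k)$. 1) Let $M$ be a bounded operator on $\mathcal E$ commuting with all translations. Then the series $\widetilde M(z)$ converges absolutely at every interior point $z$ of $\mathbb Z^k_{\mathcal E}$, and the closure of the image under $\widetilde M$ of the interior of $\mathbb Z^k_{\mathcal E}$ is contained in $\sigma(M)$. 2) Let $M\in\mathcal A$. Then there is exactly one continuous function on $\mathbb Z^k_{\mathcal E}$, again denoted $\widetilde M$, such that for every $z\in\mathbb Z^k_{\mathcal E}$ the function $(\eta_1,\dots,\eta_k)\mapsto\widetilde M(z_1\eta_1,\dots,z_k\eta_k)$ on $\mathbb T^k$ has the Fourier coefficients $\widehat M(n)z^n$, $n\in\mathbb Z^k$. It coincides with the series $\sum_n\widehat M(n)z^n$ at every point of $\mathbb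 Z^k_{\mathcal E}$ where this series converges absolutely, it is the uniform limit on $\mathbb Z^k_{\mathcal E}$ of $\tilde\phi_j$ whenever $\phi_j\in F(\mathbb Z^k)$ and $\|M_{\phi_j}-M\|\to0$, and $$\widetilde M(\mathbb Z^k_{\mathcal E})=\sigma(M).$$ -/

import Mathlib

open Filter Topology

noncomputable section

/-- The Laurent monomial `z ^ n = z₁ ^ n₁ ⋯ z_k ^ n_k`, for `n ∈ ℤ^k`. -/
def laurentMonomial {k : ℕ} (z : Fin k → ℂ) (n : Fin k → ℤ) : ℂ := ∏ i, z i ^ n i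

/-- The Laurent polynomial `∑ φ(n) z ^ n` of a finitely supported sequence `φ` on `ℤ^k`. -/
def laurentPolynomial {k : ℕ} (φ : (Fin k → ℤ) →₀ ℂ) (z : Fin k → ℂ) : ℂ :=
  φ.sum fun n c => c * laurentMonomial z n

/-- A structure of Banach space of sequences on `ℤ^k` on the complex normed space `E` (complete
where it is used), satisfying the standing hypotheses. The space `E` is identified with a linear
subspace of `ℂ^(ℤ^k)` through the injective linear map `toSeq`. -/
structure BanachSequenceSpace (k : ℕ) (E : Type*) [NormedAddCommGroup E] [NormedSpace ℂ E] where
  /-- The sequence of an element of the space. -/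
  toSeq : E →ₗ[ℂ] ((Fin k → ℤ) → ℂ)
  toSeq_injective : Function.Injective toSeq
  /-- All finitely supported sequences belong to the space. -/
  exists_of_finite : ∀ a : (Fin k → ℤ) → ℂ, a.support.Finite → ∃ x, toSeq x = a
  /-- The finitely supported sequences are dense. -/
  dense_finite : Dense {x : E | (toSeq x).support.Finite}
  /-- The coordinates are continuous. -/
  continuous_coord : ∀ n : Fin k → ℤ, Continuous fun x => toSeq x n
  /-- For `z` in the torus, `x ↦ (x(n) z ^ n)` maps the space into itself, with norms bounded
  uniformly in `z`. -/
  modulation : ∃ C : ℝ, ∀ z : Fin k → ℂ, (∀ i, ‖z i‖ = 1) → ∀ x : E,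
    ∃ y : E, (∀ n, toSeq y n = toSeq x n * laurentMonomial z n) ∧ ‖y‖ ≤ C * ‖x‖
  /-- The translations (in all directions, positive and negative) map the space into itself. Their
  boundedness follows from the closed graph theorem. -/
  exists_translate : ∀ (m : Fin k → ℤ) (x : E), ∃ y : E, ∀ n, toSeq y n = toSeq x (n - m)

namespace BanachSequenceSpace

variable {k : ℕ} {E : Type*} [NormedAddCommGroup E] [NormedSpace ℂ E]

/-- The translation by `m ∈ ℤ^k`, as a linear map. -/
def translationₗ (X : BanachSequenceSpace k E) (m : Fin k → ℤ) : E →ₗ[ℂ] E where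
  toFun x := (X.exists_translate m x).choose
  map_add' x y := by
    apply X.toSeq_injective
    funext n
    rw [(X.exists_translate m (x + y)).choose_spec n, map_add, map_add, Pi.add_apply, Pi.add_apply,
      (X.exists_translate m x).choose_spec n, (X.exists_translate m y).choose_spec n]
  map_smul' c x := by
    apply X.toSeq_injective
    funext n
    rw [(X.exists_translate m (c • x)).choose_spec n, map_smul, map_smul, Pi.smul_apply,
      Pi.smul_apply, (X.exists_translate m x).choose_spec n, RingHom.id_apply]

theorem toSeq_translationₗ (X : BanachSequenceSpace k E) (m : Fin k → ℤ) (x : E)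
    (n : Fin k → ℤ) : X.toSeq (X.translationₗ m x) n = X.toSeq x (n - m) :=
  (X.exists_translate m x).choose_spec n

theorem translationₗ_closed (X : BanachSequenceSpace k E) (m : Fin k → ℤ) (u : ℕ → E) (x y : E)
    (hx : Tendsto u atTop (𝓝 x)) (hy : Tendsto (X.translationₗ m ∘ u) atTop (𝓝 y)) :
    y = X.translationₗ m x := by
  apply X.toSeq_injective
  funext n
  have h1 := ((X.continuous_coord n).tendsto y).comp hy
  have h2 := ((X.continuous_coord (n - m)).tendsto x).comp hx
  rw [X.toSeq_translationₗ]
  refine tendsto_nhds_unique h1 (h2.congr fun j => ?_)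
  simp [X.toSeq_translationₗ]

/-- The sequence which is `1` at `0` and `0` elsewhere, as an element of the space. -/
def unitSeq (X : BanachSequenceSpace k E) : E :=
  (X.exists_of_finite (Pi.single 0 1)
    ((Set.finite_singleton 0).subset Pi.support_single_subset)).choose

theorem toSeq_unitSeq (X : BanachSequenceSpace k E) : X.toSeq X.unitSeq = Pi.single 0 1 :=
  (X.exists_of_finite (Pi.single 0 1)
    ((Set.finite_singleton 0).subset Pi.support_single_subset)).choose_spec

/-- The sequence of an operator: the value of the operator at the unit sequence. -/
def coeff (X : BanachSequenceSpace k E) (M : E →L[ℂ] E) (n : Fin k → ℤ) : ℂ :=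
  X.toSeq (M X.unitSeq) n

variable [CompleteSpace E]

/-- The translation by `m ∈ ℤ^k`, as a bounded operator: `(S_m x)(n) = x(n - m)`. -/
def translation (X : BanachSequenceSpace k E) (m : Fin k → ℤ) : E →L[ℂ] E :=
  ContinuousLinearMap.ofSeqClosedGraph (X.translationₗ_closed m)

theorem toSeq_translation (X : BanachSequenceSpace k E) (m : Fin k → ℤ) (x : E)
    (n : Fin k → ℤ) : X.toSeq (X.translation m x) n = X.toSeq x (n - m) :=
  X.toSeq_translationₗ m x n

/-- The multipliers: the bounded operators commuting with all translations. -/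
def IsMultiplier (X : BanachSequenceSpace k E) (M : E →L[ℂ] E) : Prop :=
  ∀ m : Fin k → ℤ, Commute M (X.translation m)

/-- The operator `M_φ` of convolution by the finitely supported sequence `φ`. -/
def convOp (X : BanachSequenceSpace k E) (φ : (Fin k → ℤ) →₀ ℂ) : E →L[ℂ] E :=
  φ.sum fun m c => c • X.translation m

theorem toSeq_convOp (X : BanachSequenceSpace k E) (φ : (Fin k → ℤ) →₀ ℂ) (x : E)
    (n : Fin k → ℤ) :
    X.toSeq (X.convOp φ x) n = ∑ m ∈ φ.support, φ m * X.toSeq x (n - m) := by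
  simp [convOp, Finsupp.sum, X.toSeq_translation]

/-- The closure, in the operator norm, of the algebra generated by the operators `M_φ`. -/
def convAlgebra (X : BanachSequenceSpace k E) : Subalgebra ℂ (E →L[ℂ] E) :=
  (Algebra.adjoin ℂ (Set.range X.convOp)).topologicalClosure

/-- The set of all `z` (with nonzero coordinates, so that Laurent polynomials are defined at `z`)
such that `|∑ φ(n) z ^ n| ≤ ‖M_φ‖` for every finitely supported `φ`. -/
def jointSpectrum (X : BanachSequenceSpace k E) : Set (Fin k → ℂ) :=
  {z | (∀ i, z i ≠ 0) ∧ ∀ φ : (Fin k → ℤ) →₀ ℂ, ‖laurentPolynomial φ z‖ ≤ ‖X.convOp φ‖}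

/-- The symbol `∑ n, (coeff M n) z ^ n` of an operator, at the points where the series converges
(absolutely). -/
def symbol (X : BanachSequenceSpace k E) (M : E →L[ℂ] E) (z : Fin k → ℂ) : ℂ :=
  ∑' n : Fin k → ℤ, X.coeff M n * laurentMonomial z n

/-- `g` is a continuous function on the joint spectrum which has `∑ n, (coeff M n) z ^ n` as its
Laurent series: for every `z` in the joint spectrum, the function `η ↦ g (z₁ η₁, …, z_k η_k)` on the
torus has the Fourier coefficients `(coeff M n) z ^ n`. This is the symbol of `M` on the whole
joint spectrum, including the points where the series does not converge. -/
def IsContinuousSymbol (X : BanachSequenceSpace k E) (M : E →L[ℂ] E)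
    (g : (Fin k → ℂ) → ℂ) : Prop :=
  ContinuousOn g X.jointSpectrum ∧
    ∀ z ∈ X.jointSpectrum, ∀ n : Fin k → ℤ,
      UnitAddTorus.mFourierCoeff
        (fun t : UnitAddTorus (Fin k) => g fun i => z i * (AddCircle.toCircle (t i) : ℂ)) n =
      X.coeff M n * laurentMonomial z n

end BanachSequenceSpace

end

/-! The torus acts on operators by conjugation with modulations, `conj t M`, and everything comes
from harmonic analysis of this action. Translations are eigenvectors: `conj t` multiplies
`translation m` by the character `mFourier m t`. Hence for a multiplier M the orbit t ↦ `conj t M` x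
has n-th Fourier coefficient `coeff M n • translation n x`. For a general multiplier the orbit is
only strongly continuous, so it is tested on vectors x.

Part 1. Bounding a Fourier coefficient by the supremum gives ‖`coeff M n • translation n`‖ ≤ C²‖M‖,
with C the modulation bound; the definition of the joint spectrum turns this into |coeff M n · zⁿ| ≤
C²‖M‖. At an interior point there is room to move each |zᵢ| both ways, so the terms decay
geometrically. If c - M had an inverse R for c = `symbol M z`, then R would also be a multiplier
with a convergent series at z. Symbols multiply, so 0 · `symbol R z` = 1, which is absurd. The
spectrum is closed, so the closure of the image lies in it.

Part 2. The joint spectrum is the character space of the commutative Banach algebra A =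
`convAlgebra`: a character is determined by its values on the unit translations, and the defining
inequality lets evaluation at z extend from Laurent polynomials to A. Gelfand theory then gives the
image as the spectrum relative to A. It is also the spectrum among all operators because A is
inverse closed: A contains every multiplier whose orbit is norm continuous, and inversion preserves
norm continuity. The joint spectrum is rotation invariant, so a continuous function on it with
prescribed Fourier coefficients on each torus orbit is unique. -/

noncomputable section

open UnitAddTorus MeasureTheory

/-! ### Fourier coefficients of scalar and vector valued functions on the torus. -/

namespace UnitAddTorus

variable {d : Type*} [Fintype d]

/-- The normalised Haar measure of the torus. -/
abbrev haarTorus (d : Type*) [Fintype d] : Measure (UnitAddTorus d) :=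
  Measure.pi fun _ => AddCircle.haarAddCircle

theorem mFourierCoeff_eq_integral_haarTorus {F : Type*} [NormedAddCommGroup F] [NormedSpace ℂ F]
    (f : UnitAddTorus d → F) (n : d → ℤ) :
    mFourierCoeff f n = ∫ t, mFourier (-n) t • f t ∂haarTorus d := rfl

theorem mFourier_apply_add (n : d → ℤ) (s t : UnitAddTorus d) :
    mFourier n (s + t) = mFourier n s * mFourier n t := by
  simp [mFourier, fourier_apply, smul_add, AddCircle.toCircle_add, Finset.prod_mul_distrib]

theorem mFourier_apply_zero (n : d → ℤ) : mFourier n (0 : UnitAddTorus d) = 1 := by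
  simp [mFourier]

theorem mFourier_apply_neg (n : d → ℤ) (t : UnitAddTorus d) :
    mFourier n (-t) = mFourier (-n) t := by
  simp [mFourier, fourier_apply]

theorem norm_mFourier_apply (n : d → ℤ) (t : UnitAddTorus d) : ‖mFourier n t‖ = 1 := by
  simp only [mFourier, fourier_apply, ContinuousMap.coe_mk, norm_prod, Circle.norm_coe,
    Finset.prod_const_one]

theorem integrable_haarTorus {F : Type*} [NormedAddCommGroup F] {f : UnitAddTorus d → F}
    (hf : Continuous f) : Integrable f (haarTorus d) :=
  hf.integrable_of_hasCompactSupport (HasCompactSupport.of_compactSpace f)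

theorem mFourierCoeff_mFourier (m n : d → ℤ) :
    mFourierCoeff (fun t => mFourier m t) n = if n = m then 1 else 0 := by
  have h := orthonormal_iff_ite.mp (orthonormal_mFourier (d := d)) n m
  rw [← h]
  simp only [ContinuousMap.inner_toLp, ← mFourier_neg]
  rw [mFourierCoeff_eq_integral_haarTorus]
  exact integral_congr_ae (Eventually.of_forall fun t => mul_comm _ _)

theorem mFourierCoeff_const_mul_mFourier (c : ℂ) (m n : d → ℤ) :
    mFourierCoeff (fun t => c * mFourier m t) n = if n = m then c else 0 := by
  have h := mFourierCoeff_mFourier m n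
  rw [mFourierCoeff_eq_integral_haarTorus] at h ⊢
  have : (fun t : UnitAddTorus d => mFourier (-n) t • (c * mFourier m t)) =
      fun t => c * (mFourier (-n) t • mFourier m t) := by
    funext t
    simp only [smul_eq_mul]
    ring
  rw [this, integral_const_mul, h]
  simp

section Vector

variable {F G : Type*} [NormedAddCommGroup F] [NormedSpace ℂ F] [NormedAddCommGroup G]
  [NormedSpace ℂ G]

theorem integrable_mFourier_smul {f : UnitAddTorus d → F} (hf : Continuous f) (n : d → ℤ) :
    Integrable (fun t => mFourier n t • f t) (haarTorus d) :=
  integrable_haarTorus ((mFourier n).continuous.smul hf)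

theorem mFourierCoeff_clm_comp [CompleteSpace F] [CompleteSpace G] (L : F →L[ℂ] G)
    {f : UnitAddTorus d → F} (hf : Continuous f) (n : d → ℤ) :
    mFourierCoeff (fun t => L (f t)) n = L (mFourierCoeff f n) := by
  rw [mFourierCoeff_eq_integral_haarTorus, mFourierCoeff_eq_integral_haarTorus,
    ← L.integral_comp_comm (integrable_mFourier_smul hf _)]
  simp

theorem norm_mFourierCoeff_le {f : UnitAddTorus d → F} {C : ℝ} (hf : ∀ t, ‖f t‖ ≤ C)
    (n : d → ℤ) : ‖mFourierCoeff f n‖ ≤ C := by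
  rw [mFourierCoeff_eq_integral_haarTorus]
  have h := norm_integral_le_of_norm_le_const (μ := haarTorus d)
    (f := fun t => mFourier (-n) t • f t) (C := C)
    (Eventually.of_forall fun t => by rw [norm_smul, norm_mFourier_apply, one_mul]; exact hf t)
  simpa using h

theorem mFourierCoeff_add {f g : UnitAddTorus d → F} (hf : Continuous f) (hg : Continuous g)
    (n : d → ℤ) : mFourierCoeff (fun t => f t + g t) n = mFourierCoeff f n + mFourierCoeff g n := by
  simp only [mFourierCoeff_eq_integral_haarTorus, smul_add]
  exact integral_add (integrable_mFourier_smul hf _) (integrable_mFourier_smul hg _)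

theorem mFourierCoeff_sub {f g : UnitAddTorus d → F} (hf : Continuous f) (hg : Continuous g)
    (n : d → ℤ) : mFourierCoeff (fun t => f t - g t) n = mFourierCoeff f n - mFourierCoeff g n := by
  simp only [mFourierCoeff_eq_integral_haarTorus, smul_sub]
  exact integral_sub (integrable_mFourier_smul hf _) (integrable_mFourier_smul hg _)

theorem mFourierCoeff_const_smul (c : ℂ) (f : UnitAddTorus d → F) (n : d → ℤ) :
    mFourierCoeff (fun t => c • f t) n = c • mFourierCoeff f n := by
  simp only [mFourierCoeff_eq_integral_haarTorus, smul_comm _ c]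
  exact integral_smul _ _

end Vector

theorem hasSum_mFourierCoeff {f : UnitAddTorus d → ℂ} (hf : Continuous f)
    (h : Summable (mFourierCoeff f)) : HasSum (mFourierCoeff f) (f 0) := by
  have := hasSum_mFourier_series_apply_of_summable (f := ⟨f, hf⟩) h 0
  simpa [mFourier_apply_zero] using this

/-- The zero series is summable, so the Fourier series of f converges to f. The origin suffices
below, since orbits are read off at the trivial rotation. -/
theorem apply_zero_eq_zero_of_mFourierCoeff_eq_zero {f : UnitAddTorus d → ℂ} (hf : Continuous f)
    (h : ∀ n, mFourierCoeff f n = 0) : f 0 = 0 := by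
  have h0 : mFourierCoeff f = 0 := funext h
  have := hasSum_mFourierCoeff hf (h0 ▸ summable_zero)
  rw [h0] at this
  exact this.unique hasSum_zero

end UnitAddTorus

/-! ### Auxiliary estimates and rotations of Laurent monomials. -/

theorem continuous_of_mem_closure {T V W : Type*} [TopologicalSpace T] [NormedAddCommGroup V]
    [NormedAddCommGroup W] {f : T → V → W} {C : ℝ}
    (hf : ∀ t x y, ‖f t x - f t y‖ ≤ C * ‖x - y‖) {s : Set V}
    (hs : ∀ x ∈ s, Continuous fun t => f t x) {x : V} (hx : x ∈ closure s) :
    Continuous fun t => f t x := by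
  refine continuous_of_uniform_approx_of_continuous fun u hu => ?_
  obtain ⟨ε, hε, hεu⟩ := Metric.mem_uniformity_dist.1 hu
  -- No sign is assumed for C; |C| + 1 is a positive bound to divide by.
  obtain ⟨y, hy, hxy⟩ := Metric.mem_closure_iff.1 hx (ε / (|C| + 1)) (by positivity)
  refine ⟨fun t => f t y, hs y hy, fun t => hεu ?_⟩
  rw [dist_eq_norm] at hxy ⊢
  rw [lt_div_iff₀ (by positivity)] at hxy
  calc ‖f t x - f t y‖ ≤ C * ‖x - y‖ := hf t x y
    _ ≤ |C| * ‖x - y‖ := by gcongr; exact le_abs_self C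
    _ ≤ ‖x - y‖ * (|C| + 1) := by nlinarith [norm_nonneg (x - y)]
    _ < ε := hxy

/-- The power trick: if a > b, then C(b/a)^N tends to 0 but stays at least 1. It removes the
constant C from an estimate valid for all powers. -/
theorem le_of_forall_pow_le_mul_pow {a b C : ℝ} (hb : 0 ≤ b)
    (h : ∀ N : ℕ, a ^ N ≤ C * b ^ N) : a ≤ b := by
  by_contra! hab
  have ha : 0 < a := hb.trans_lt hab
  have hlim : Tendsto (fun N : ℕ => C * (b / a) ^ N) atTop (𝓝 (C * 0)) :=
    (tendsto_pow_atTop_nhds_zero_of_lt_one (by positivity) ((div_lt_one ha).2 hab)).const_mul C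
  rw [mul_zero] at hlim
  obtain ⟨N, hN⟩ := (hlim.eventually (gt_mem_nhds one_pos)).exists
  have h2 := h N
  rw [div_pow, ← mul_div_assoc, div_lt_one (by positivity)] at hN
  linarith

theorem summable_prod_pow_natAbs {k : ℕ} {r : ℝ} (hr0 : 0 ≤ r) (hr : r < 1) :
    Summable fun n : Fin k → ℤ => ∏ i, r ^ (n i).natAbs := by
  have h1 : Summable fun n : ℤ => r ^ n.natAbs := by
    refine Summable.of_nat_of_neg ?_ ?_ <;>
      simpa using summable_geometric_of_lt_one hr0 hr
  induction k with
  | zero => exact Summable.of_finite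
  | succ k ih =>
    rw [← (Fin.consEquiv fun _ => ℤ).summable_iff]
    have := h1.mul_of_nonneg ih (fun n => by positivity) (fun n => Finset.prod_nonneg fun i _ => by positivity)
    refine this.congr fun p => ?_
    simp [Fin.prod_univ_succ, Fin.consEquiv]

/-- The action of the torus on `ℂ^k` by rotation of the coordinates. -/
def rotate {k : ℕ} (z : Fin k → ℂ) (t : UnitAddTorus (Fin k)) : Fin k → ℂ :=
  fun i => z i * (AddCircle.toCircle (t i) : ℂ)

theorem laurentMonomial_zero {k : ℕ} (z : Fin k → ℂ) : laurentMonomial z 0 = 1 := by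
  simp [laurentMonomial]

theorem laurentMonomial_add {k : ℕ} {z : Fin k → ℂ} (hz : ∀ i, z i ≠ 0) (m n : Fin k → ℤ) :
    laurentMonomial z (m + n) = laurentMonomial z m * laurentMonomial z n := by
  simp [laurentMonomial, zpow_add₀ (hz _), Finset.prod_mul_distrib]

theorem laurentMonomial_ne_zero {k : ℕ} {z : Fin k → ℂ} (hz : ∀ i, z i ≠ 0) (n : Fin k → ℤ) :
    laurentMonomial z n ≠ 0 :=
  Finset.prod_ne_zero_iff.2 fun i _ => zpow_ne_zero _ (hz i)

theorem laurentMonomial_toCircle {k : ℕ} (t : UnitAddTorus (Fin k)) (n : Fin k → ℤ) :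
    laurentMonomial (fun i => (AddCircle.toCircle (t i) : ℂ)) n = mFourier n t := by
  simp [laurentMonomial, mFourier, fourier_apply, AddCircle.toCircle_zsmul]

theorem laurentMonomial_rotate {k : ℕ} (z : Fin k → ℂ) (t : UnitAddTorus (Fin k))
    (n : Fin k → ℤ) :
    laurentMonomial (rotate z t) n = laurentMonomial z n * mFourier n t := by
  rw [← laurentMonomial_toCircle]
  simp [laurentMonomial, rotate, mul_zpow, Finset.prod_mul_distrib]

theorem rotate_ne_zero {k : ℕ} {z : Fin k → ℂ} (hz : ∀ i, z i ≠ 0) (t : UnitAddTorus (Fin k))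
    (i : Fin k) : rotate z t i ≠ 0 :=
  mul_ne_zero (hz i) (Circle.coe_ne_zero _)

theorem rotate_zero {k : ℕ} (z : Fin k → ℂ) : rotate z 0 = z := by
  funext i
  simp [rotate]

theorem continuous_rotate {k : ℕ} (z : Fin k → ℂ) : Continuous (rotate z) := by
  unfold rotate
  fun_prop

/-! ### Modulations and the conjugation action of the torus. -/

namespace BanachSequenceSpace

variable {k : ℕ} {E : Type*} [NormedAddCommGroup E] [NormedSpace ℂ E]

theorem exists_mod (X : BanachSequenceSpace k E) : ∃ C : ℝ, 0 ≤ C ∧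
    ∀ (t : UnitAddTorus (Fin k)) (x : E),
      ∃ y : E, (∀ n, X.toSeq y n = X.toSeq x n * mFourier n t) ∧ ‖y‖ ≤ C * ‖x‖ := by
  obtain ⟨C, hC⟩ := X.modulation
  refine ⟨|C|, abs_nonneg C, fun t x => ?_⟩
  obtain ⟨y, hy, hyx⟩ := hC (fun i => (AddCircle.toCircle (t i) : ℂ)) (fun i => Circle.norm_coe _) x
  refine ⟨y, fun n => by rw [hy, laurentMonomial_toCircle], hyx.trans ?_⟩
  gcongr
  exact le_abs_self C

/-- A uniform bound for the norms of the modulations. -/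
def modBound (X : BanachSequenceSpace k E) : ℝ := X.exists_mod.choose

theorem modBound_nonneg (X : BanachSequenceSpace k E) : 0 ≤ X.modBound :=
  X.exists_mod.choose_spec.1

/-- The modulation `x ↦ (x(n) z ^ n)` for `z` in the torus, as a bounded operator. -/
def mod (X : BanachSequenceSpace k E) (t : UnitAddTorus (Fin k)) : E →L[ℂ] E :=
  LinearMap.mkContinuous
    { toFun := fun x => (X.exists_mod.choose_spec.2 t x).choose
      map_add' := fun x y => by
        apply X.toSeq_injective
        funext n
        rw [(X.exists_mod.choose_spec.2 t (x + y)).choose_spec.1 n, map_add, map_add,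
          Pi.add_apply, Pi.add_apply, (X.exists_mod.choose_spec.2 t x).choose_spec.1 n,
          (X.exists_mod.choose_spec.2 t y).choose_spec.1 n, add_mul]
      map_smul' := fun c x => by
        apply X.toSeq_injective
        funext n
        rw [(X.exists_mod.choose_spec.2 t (c • x)).choose_spec.1 n, map_smul, map_smul,
          Pi.smul_apply, Pi.smul_apply, (X.exists_mod.choose_spec.2 t x).choose_spec.1 n,
          RingHom.id_apply, smul_eq_mul, smul_eq_mul, mul_assoc] }
    X.modBound (fun x => (X.exists_mod.choose_spec.2 t x).choose_spec.2)

theorem toSeq_mod (X : BanachSequenceSpace k E) (t : UnitAddTorus (Fin k)) (x : E)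
    (n : Fin k → ℤ) : X.toSeq (X.mod t x) n = X.toSeq x n * mFourier n t :=
  (X.exists_mod.choose_spec.2 t x).choose_spec.1 n

theorem norm_mod_le (X : BanachSequenceSpace k E) (t : UnitAddTorus (Fin k)) :
    ‖X.mod t‖ ≤ X.modBound :=
  LinearMap.mkContinuous_norm_le _ X.modBound_nonneg _

theorem ext_toSeq (X : BanachSequenceSpace k E) {x y : E}
    (h : ∀ n, X.toSeq x n = X.toSeq y n) : x = y :=
  X.toSeq_injective (funext h)

theorem mod_zero (X : BanachSequenceSpace k E) : X.mod 0 = 1 := by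
  ext x
  refine X.ext_toSeq fun n => ?_
  rw [toSeq_mod, mFourier_apply_zero, mul_one, one_apply_eq_self]

theorem mod_add (X : BanachSequenceSpace k E) (s t : UnitAddTorus (Fin k)) :
    X.mod (s + t) = X.mod s * X.mod t := by
  ext x
  refine X.ext_toSeq fun n => ?_
  rw [mul_apply_eq_comp, toSeq_mod, toSeq_mod, toSeq_mod, mFourier_apply_add]
  ring

theorem mod_mul_mod_neg (X : BanachSequenceSpace k E) (t : UnitAddTorus (Fin k)) :
    X.mod t * X.mod (-t) = 1 := by
  rw [← mod_add, add_neg_cancel, mod_zero]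

theorem mod_neg_mul_mod (X : BanachSequenceSpace k E) (t : UnitAddTorus (Fin k)) :
    X.mod (-t) * X.mod t = 1 := by
  rw [← mod_add, neg_add_cancel, mod_zero]

/-- The coordinate at `n`, as a continuous linear functional. -/
def coord (X : BanachSequenceSpace k E) (n : Fin k → ℤ) : E →L[ℂ] ℂ :=
  ⟨(LinearMap.proj n).comp X.toSeq, X.continuous_coord n⟩

theorem coord_apply (X : BanachSequenceSpace k E) (n : Fin k → ℤ) (x : E) :
    X.coord n x = X.toSeq x n := rfl

/-- The conjugation of an operator by a modulation. -/
def conj (X : BanachSequenceSpace k E) (t : UnitAddTorus (Fin k)) (T : E →L[ℂ] E) : E →L[ℂ] E :=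
  X.mod t * T * X.mod (-t)

theorem conj_mul (X : BanachSequenceSpace k E) (t : UnitAddTorus (Fin k)) (S T : E →L[ℂ] E) :
    X.conj t (S * T) = X.conj t S * X.conj t T := by
  have h := X.mod_neg_mul_mod t
  calc X.conj t (S * T) = X.mod t * S * 1 * T * X.mod (-t) := by simp [conj, mul_assoc]
    _ = X.conj t S * X.conj t T := by rw [← h]; simp [conj, mul_assoc]

theorem conj_one (X : BanachSequenceSpace k E) (t : UnitAddTorus (Fin k)) : X.conj t 1 = 1 := by
  rw [conj, mul_one, mod_mul_mod_neg]

theorem conj_add (X : BanachSequenceSpace k E) (t : UnitAddTorus (Fin k)) (S T : E →L[ℂ] E) :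
    X.conj t (S + T) = X.conj t S + X.conj t T := by
  simp [conj, mul_add, add_mul]

theorem conj_sub (X : BanachSequenceSpace k E) (t : UnitAddTorus (Fin k)) (S T : E →L[ℂ] E) :
    X.conj t (S - T) = X.conj t S - X.conj t T := by
  simp [conj, mul_sub, sub_mul]

theorem conj_smul (X : BanachSequenceSpace k E) (t : UnitAddTorus (Fin k)) (c : ℂ)
    (T : E →L[ℂ] E) : X.conj t (c • T) = c • X.conj t T := by
  simp [conj]

theorem conj_zero (X : BanachSequenceSpace k E) (T : E →L[ℂ] E) : X.conj 0 T = T := by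
  simp [conj, mod_zero]

theorem norm_conj_le (X : BanachSequenceSpace k E) (t : UnitAddTorus (Fin k)) (T : E →L[ℂ] E) :
    ‖X.conj t T‖ ≤ X.modBound ^ 2 * ‖T‖ := by
  have h0 := X.modBound_nonneg
  calc ‖X.conj t T‖ ≤ ‖X.mod t * T‖ * ‖X.mod (-t)‖ := norm_mul_le _ _
    _ ≤ (‖X.mod t‖ * ‖T‖) * ‖X.mod (-t)‖ := by gcongr; exact norm_mul_le _ _
    _ ≤ (X.modBound * ‖T‖) * X.modBound := by gcongr <;> exact X.norm_mod_le _
    _ = X.modBound ^ 2 * ‖T‖ := by ring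

theorem nontrivial (X : BanachSequenceSpace k E) : Nontrivial E := by
  refine ⟨X.unitSeq, 0, fun h => ?_⟩
  have := congrFun X.toSeq_unitSeq 0
  rw [h] at this
  simp at this

theorem coeff_sub (X : BanachSequenceSpace k E) (S T : E →L[ℂ] E) (n : Fin k → ℤ) :
    X.coeff (S - T) n = X.coeff S n - X.coeff T n := by
  simp [coeff]

theorem coeff_smul_one (X : BanachSequenceSpace k E) (c : ℂ) (n : Fin k → ℤ) :
    X.coeff (c • 1) n = if n = 0 then c else 0 := by
  simp [coeff, toSeq_unitSeq, Pi.single_apply]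

variable [CompleteSpace E]

/-- The sequence which is `1` at `m` and `0` elsewhere, as an element of the space. -/
def basisSeq (X : BanachSequenceSpace k E) (m : Fin k → ℤ) : E := X.translation m X.unitSeq

theorem toSeq_basisSeq (X : BanachSequenceSpace k E) (m n : Fin k → ℤ) :
    X.toSeq (X.basisSeq m) n = if n = m then 1 else 0 := by
  rw [basisSeq, toSeq_translation, toSeq_unitSeq, Pi.single_apply]
  simp [sub_eq_zero]

theorem span_basisSeq_dense (X : BanachSequenceSpace k E) :
    Dense (Submodule.span ℂ (Set.range X.basisSeq) : Set E) := by
  refine X.dense_finite.mono fun x hx => ?_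
  have : x = ∑ m ∈ hx.toFinset, X.toSeq x m • X.basisSeq m := by
    refine X.ext_toSeq fun n => ?_
    simp only [map_sum, map_smul, Finset.sum_apply, Pi.smul_apply, toSeq_basisSeq, smul_eq_mul,
      mul_ite, mul_one, mul_zero, Finset.sum_ite_eq, Set.Finite.mem_toFinset,
      Function.mem_support]
    split_ifs with h
    · rfl
    · exact not_not.1 h
  rw [this]
  exact Submodule.sum_mem _ fun m _ => Submodule.smul_mem _ _ (Submodule.subset_span ⟨m, rfl⟩)

theorem ext_basisSeq (X : BanachSequenceSpace k E) {S T : E →L[ℂ] E}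
    (h : ∀ m, S (X.basisSeq m) = T (X.basisSeq m)) : S = T :=
  ContinuousLinearMap.ext_on X.span_basisSeq_dense (by rintro _ ⟨m, rfl⟩; exact h m)

theorem mod_basisSeq (X : BanachSequenceSpace k E) (t : UnitAddTorus (Fin k)) (m : Fin k → ℤ) :
    X.mod t (X.basisSeq m) = mFourier m t • X.basisSeq m := by
  refine X.ext_toSeq fun n => ?_
  rw [toSeq_mod, map_smul, Pi.smul_apply, toSeq_basisSeq]
  split_ifs with h
  · simp [h]
  · simp

/-- On a basis sequence the modulation is a scalar character; uniform boundedness and density carry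
continuity over to every x. -/
theorem continuous_mod_apply (X : BanachSequenceSpace k E) (x : E) :
    Continuous fun t => X.mod t x := by
  refine continuous_of_mem_closure (f := fun t x => X.mod t x) (C := X.modBound)
    (fun t x y => ?_) (s := Submodule.span ℂ (Set.range X.basisSeq)) (fun x hx => ?_)
    (X.span_basisSeq_dense x)
  · rw [← map_sub]
    exact (X.mod t).le_of_opNorm_le (X.norm_mod_le t) _
  · induction hx using Submodule.span_induction with
    | mem x hx =>
      obtain ⟨m, rfl⟩ := hx
      simp only [mod_basisSeq]
      fun_prop
    | zero => simpa using continuous_const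
    | add x y _ _ hx hy => simpa using! hx.add hy
    | smul c x _ hx => simpa using! hx.const_smul c

theorem continuous_mod_apply_comp (X : BanachSequenceSpace k E) {f : UnitAddTorus (Fin k) → E}
    (hf : Continuous f) : Continuous fun t => X.mod t (f t) := by
  rw [continuous_iff_continuousAt]
  intro t
  have h1 : Tendsto (fun s => X.mod s (f t)) (𝓝 t) (𝓝 (X.mod t (f t))) :=
    (X.continuous_mod_apply (f t)).tendsto t
  have h2 : Tendsto (fun s => X.mod s (f s - f t)) (𝓝 t) (𝓝 0) := by
    have h3 : Tendsto (fun s => X.modBound * ‖f s - f t‖) (𝓝 t) (𝓝 0) := by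
      have : Continuous fun s => X.modBound * ‖f s - f t‖ := by fun_prop
      simpa using this.tendsto t
    exact squeeze_zero_norm (fun s => (X.mod s).le_of_opNorm_le (X.norm_mod_le s) _) h3
  have h4 := h2.add h1
  simpa [ContinuousAt] using h4

theorem continuous_conj_apply (X : BanachSequenceSpace k E) (T : E →L[ℂ] E) (x : E) :
    Continuous fun t => X.conj t T x :=
  X.continuous_mod_apply_comp
    (T.continuous.comp ((X.continuous_mod_apply x).comp continuous_neg))

theorem conj_translation (X : BanachSequenceSpace k E) (t : UnitAddTorus (Fin k))
    (m : Fin k → ℤ) : X.conj t (X.translation m) = mFourier m t • X.translation m := by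
  ext x
  refine X.ext_toSeq fun n => ?_
  simp only [conj, mul_apply_eq_comp, toSeq_mod, toSeq_translation,
    smul_apply, map_smul, Pi.smul_apply, smul_eq_mul, mFourier_apply_neg]
  have h1 : mFourier n t = mFourier m t * mFourier (n - m) t := by
    rw [← mFourier_add, add_sub_cancel]
  have h2 : mFourier (-(n - m)) t * mFourier (n - m) t = 1 := by
    rw [← mFourier_add, neg_add_cancel, mFourier_zero, ContinuousMap.one_apply]
  rw [h1]
  linear_combination (X.toSeq x (n - m) * mFourier m t) * h2

theorem translation_add (X : BanachSequenceSpace k E) (m n : Fin k → ℤ) :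
    X.translation (m + n) = X.translation m * X.translation n := by
  ext x
  refine X.ext_toSeq fun j => ?_
  simp [toSeq_translation, sub_sub]

theorem translation_zero (X : BanachSequenceSpace k E) : X.translation 0 = 1 := by
  ext x
  refine X.ext_toSeq fun j => ?_
  simp [toSeq_translation]

/-! ### Multipliers: Fourier coefficients of orbits and products of symbols. -/

namespace IsMultiplier

variable {X : BanachSequenceSpace k E} {M : E →L[ℂ] E}

theorem toSeq_apply_basisSeq (hM : X.IsMultiplier M) (m n : Fin k → ℤ) :
    X.toSeq (M (X.basisSeq m)) n = X.coeff M (n - m) := by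
  have : M (X.basisSeq m) = X.translation m (M X.unitSeq) :=
    congrArg (fun T : E →L[ℂ] E => T X.unitSeq) (hM m).eq
  rw [this, toSeq_translation, coeff]

/-- The m-th coordinate of the orbit is a multiple of the single character of index m - j. -/
theorem mFourierCoeff_conj_basisSeq (hM : X.IsMultiplier M) (j n : Fin k → ℤ) :
    mFourierCoeff (fun t => X.conj t M (X.basisSeq j)) n =
      X.coeff M n • X.translation n (X.basisSeq j) := by
  refine X.ext_toSeq fun m => ?_
  rw [← coord_apply, ← mFourierCoeff_clm_comp _ (X.continuous_conj_apply M _)]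
  have : (fun t => X.coord m (X.conj t M (X.basisSeq j))) =
      fun t => X.coeff M (m - j) * mFourier (m - j) t := by
    funext t
    simp only [coord_apply, conj, mul_apply_eq_comp, mod_basisSeq, map_smul,
      toSeq_mod, hM.toSeq_apply_basisSeq, mFourier_apply_neg, smul_eq_mul]
    rw [sub_eq_add_neg m j, mFourier_add]
    ring
  rw [this, mFourierCoeff_const_mul_mFourier, map_smul, Pi.smul_apply, toSeq_translation,
    toSeq_basisSeq]
  by_cases h : n = m - j
  · subst h
    simp
  · have h' : ¬ m - n = j := fun h' => h (by rw [← h']; abel)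
    simp [h, h']

/-- The Fourier coefficients of `t ↦ ψ_t M ψ_t⁻¹ x` are the terms of the formal convolution series
of `M`. -/
theorem mFourierCoeff_conj_apply (hM : X.IsMultiplier M) (n : Fin k → ℤ) (x : E) :
    mFourierCoeff (fun t => X.conj t M x) n = X.coeff M n • X.translation n x := by
  have hC := X.modBound_nonneg
  -- Both sides are bounded operators in x, so agreement on the basis sequences is enough.
  let L : E →L[ℂ] E := LinearMap.mkContinuous
    { toFun := fun x => mFourierCoeff (fun t => X.conj t M x) n
      map_add' := fun x y => by
        simp only [map_add]
        exact mFourierCoeff_add (X.continuous_conj_apply M x) (X.continuous_conj_apply M y) n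
      map_smul' := fun c x => by
        simp only [map_smul, RingHom.id_apply]
        exact mFourierCoeff_const_smul c _ n }
    (X.modBound ^ 2 * ‖M‖)
    (fun x => norm_mFourierCoeff_le
      (fun t => (X.conj t M).le_of_opNorm_le (X.norm_conj_le t M) x) n)
  have : L = X.coeff M n • X.translation n :=
    X.ext_basisSeq fun j => hM.mFourierCoeff_conj_basisSeq j n
  exact congrArg (fun T : E →L[ℂ] E => T x) this

theorem norm_coeff_smul_translation_le (hM : X.IsMultiplier M) (n : Fin k → ℤ) :
    ‖X.coeff M n • X.translation n‖ ≤ X.modBound ^ 2 * ‖M‖ := by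
  have hC := X.modBound_nonneg
  refine ContinuousLinearMap.opNorm_le_bound _ (by positivity) fun x => ?_
  rw [smul_apply, ← hM.mFourierCoeff_conj_apply]
  exact norm_mFourierCoeff_le (fun t => (X.conj t M).le_of_opNorm_le (X.norm_conj_le t M) x) n

/-- The terms are the Fourier coefficients of the continuous function t ↦ (M ψ_t x)(n), whose value
at t = 0 is (M x)(n). -/
theorem hasSum_apply (hM : X.IsMultiplier M) (x : E) (n : Fin k → ℤ)
    (h : Summable fun m => X.toSeq x m * X.coeff M (n - m)) :
    HasSum (fun m => X.toSeq x m * X.coeff M (n - m)) (X.toSeq (M x) n) := by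
  have hmod : ∀ m, mFourierCoeff (fun t => X.mod t x) m = X.toSeq x m • X.basisSeq m := by
    intro m
    refine X.ext_toSeq fun j => ?_
    rw [← coord_apply, ← mFourierCoeff_clm_comp _ (X.continuous_mod_apply x)]
    simp only [coord_apply, toSeq_mod, mFourierCoeff_const_mul_mFourier, map_smul, Pi.smul_apply,
      toSeq_basisSeq, smul_eq_mul, mul_ite, mul_one, mul_zero]
    by_cases hj : m = j
    · simp [hj]
    · simp [hj, Ne.symm hj]
  have hcoeff : mFourierCoeff (fun t => X.coord n (M (X.mod t x))) =
      fun m => X.toSeq x m * X.coeff M (n - m) := by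
    funext m
    have := mFourierCoeff_clm_comp ((X.coord n).comp M) (X.continuous_mod_apply x) m
    simp only [ContinuousLinearMap.comp_apply] at this
    rw [this, hmod, map_smul, map_smul, coord_apply, hM.toSeq_apply_basisSeq, smul_eq_mul]
  have hcont : Continuous fun t => X.coord n (M (X.mod t x)) :=
    (X.coord n).continuous.comp (M.continuous.comp (X.continuous_mod_apply x))
  have := hasSum_mFourierCoeff hcont (hcoeff ▸ h)
  rwa [hcoeff, mod_zero] at this

theorem sub_smul_one (hM : X.IsMultiplier M) (c : ℂ) : X.IsMultiplier (c • 1 - M) :=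
  fun m => ((Commute.one_left _).smul_left c).sub_left (hM m)

theorem of_mul_eq_one (hM : X.IsMultiplier M) {R : E →L[ℂ] E} (h1 : M * R = 1)
    (h2 : R * M = 1) : X.IsMultiplier R := fun m => by
  have h := (hM m).eq
  calc R * X.translation m = R * X.translation m * (M * R) := by rw [h1, mul_one]
    _ = R * (X.translation m * M) * R := by simp only [mul_assoc]
    _ = (R * M) * X.translation m * R := by rw [← h]; simp only [mul_assoc]
    _ = X.translation m * R := by rw [h2, one_mul]

theorem hasSum_coeff_mul (hM : X.IsMultiplier M) {R : E →L[ℂ] E} {z : Fin k → ℂ}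
    (hz : ∀ i, z i ≠ 0) (h1 : Summable fun n => X.coeff M n * laurentMonomial z n)
    (h2 : Summable fun n => X.coeff R n * laurentMonomial z n) :
    HasSum (fun n => X.coeff (M * R) n * laurentMonomial z n)
      (X.symbol M z * X.symbol R z) := by
  have hs := summable_mul_of_summable_norm h1.norm h2.norm
  have hsum := hs.hasSum
  rw [← tsum_mul_tsum_of_summable_norm h1.norm h2.norm] at hsum
  -- The shear (n, m) ↦ (n - m, m) makes the fibre over n the convolution sum for the n-th
  -- coefficient.
  let e : (Fin k → ℤ) × (Fin k → ℤ) ≃ (Fin k → ℤ) × (Fin k → ℤ) :=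
    { toFun := fun p => (p.1 - p.2, p.2)
      invFun := fun p => (p.1 + p.2, p.2)
      left_inv := fun p => by simp
      right_inv := fun p => by simp }
  have hsum' := e.hasSum_iff.2 hsum
  refine hsum'.prod_fiberwise fun n => ?_
  have hfun : (fun m => X.toSeq (R X.unitSeq) m * X.coeff M (n - m) * laurentMonomial z n) =
      fun m => (X.coeff M (n - m) * laurentMonomial z (n - m)) *
        (X.coeff R m * laurentMonomial z m) := by
    funext m
    have : laurentMonomial z n = laurentMonomial z (n - m) * laurentMonomial z m := by
      rw [← laurentMonomial_add hz, sub_add_cancel]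
    rw [this, coeff, coeff]
    ring
  have hfib : Summable fun m =>
      X.toSeq (R X.unitSeq) m * X.coeff M (n - m) * laurentMonomial z n :=
    hfun ▸ hsum'.summable.prod_factor n
  have h3 := (hM.hasSum_apply (R X.unitSeq) n
    ((summable_mul_right_iff (laurentMonomial_ne_zero hz n)).1 hfib)).mul_right
      (laurentMonomial z n)
  rw [hfun] at h3
  exact h3

end IsMultiplier

end BanachSequenceSpace

/-! ### Laurent polynomials and rotation invariance of the joint spectrum. -/

/-- Evaluation at a point with nonzero coordinates, as a character of the algebra of Laurent
polynomials. -/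
def evalHom {k : ℕ} {z : Fin k → ℂ} (hz : ∀ i, z i ≠ 0) :
    AddMonoidAlgebra ℂ (Fin k → ℤ) →ₐ[ℂ] ℂ :=
  AddMonoidAlgebra.lift ℂ ℂ (Fin k → ℤ)
    { toFun := fun m => laurentMonomial z m.toAdd
      map_one' := laurentMonomial_zero z
      map_mul' := fun m n => laurentMonomial_add hz m.toAdd n.toAdd }

theorem evalHom_apply {k : ℕ} {z : Fin k → ℂ} (hz : ∀ i, z i ≠ 0)
    (p : AddMonoidAlgebra ℂ (Fin k → ℤ)) : evalHom hz p = laurentPolynomial p.coeff z :=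
  AddMonoidAlgebra.lift_apply _ _

theorem laurentPolynomial_single {k : ℕ} (z : Fin k → ℂ) (n : Fin k → ℤ) (c : ℂ) :
    laurentPolynomial (Finsupp.single n c) z = c * laurentMonomial z n := by
  simp [laurentPolynomial]

theorem laurentPolynomial_sub {k : ℕ} (φ ρ : (Fin k → ℤ) →₀ ℂ) (z : Fin k → ℂ) :
    laurentPolynomial (φ - ρ) z = laurentPolynomial φ z - laurentPolynomial ρ z :=
  Finsupp.sum_sub_index fun _ _ _ => sub_mul _ _ _

namespace BanachSequenceSpace

variable {k : ℕ} {E : Type*} [NormedAddCommGroup E] [NormedSpace ℂ E] [CompleteSpace E]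

/-- Convolution, as a representation of the algebra of Laurent polynomials. -/
def convHom (X : BanachSequenceSpace k E) :
    AddMonoidAlgebra ℂ (Fin k → ℤ) →ₐ[ℂ] (E →L[ℂ] E) :=
  AddMonoidAlgebra.lift ℂ (E →L[ℂ] E) (Fin k → ℤ)
    { toFun := fun m => X.translation m.toAdd
      map_one' := X.translation_zero
      map_mul' := fun m n => X.translation_add m.toAdd n.toAdd }

theorem convHom_apply (X : BanachSequenceSpace k E) (p : AddMonoidAlgebra ℂ (Fin k → ℤ)) :
    X.convHom p = X.convOp p.coeff :=
  AddMonoidAlgebra.lift_apply _ _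

theorem convOp_single (X : BanachSequenceSpace k E) (n : Fin k → ℤ) (c : ℂ) :
    X.convOp (Finsupp.single n c) = c • X.translation n := by
  simp [convOp]

theorem convOp_sub (X : BanachSequenceSpace k E) (φ ρ : (Fin k → ℤ) →₀ ℂ) :
    X.convOp (φ - ρ) = X.convOp φ - X.convOp ρ :=
  Finsupp.sum_sub_index fun _ _ _ => sub_smul _ _ _

theorem coeff_convOp (X : BanachSequenceSpace k E) (φ : (Fin k → ℤ) →₀ ℂ) (n : Fin k → ℤ) :
    X.coeff (X.convOp φ) n = φ n := by
  rw [coeff, toSeq_convOp, toSeq_unitSeq]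
  simp [Pi.single_apply, sub_eq_zero, eq_comm]

theorem norm_evalHom_le (X : BanachSequenceSpace k E) {z : Fin k → ℂ} (hz : z ∈ X.jointSpectrum)
    (p : AddMonoidAlgebra ℂ (Fin k → ℤ)) : ‖evalHom hz.1 p‖ ≤ ‖X.convHom p‖ := by
  rw [evalHom_apply, convHom_apply]
  exact hz.2 _

theorem exists_convOp_eq_conj (X : BanachSequenceSpace k E) (φ : (Fin k → ℤ) →₀ ℂ)
    (t : UnitAddTorus (Fin k)) : ∃ ρ : (Fin k → ℤ) →₀ ℂ, X.convOp ρ = X.conj t (X.convOp φ) ∧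
      ∀ z, laurentPolynomial ρ z = laurentPolynomial φ (rotate z t) := by
  refine ⟨Finsupp.onFinset φ.support (fun n => φ n * mFourier n t) (by simp +contextual), ?_,
    fun z => ?_⟩
  · rw [convOp, Finsupp.onFinset_sum _ (by simp)]
    have hsum : ∀ s : Finset (Fin k → ℤ), X.conj t (∑ m ∈ s, φ m • X.translation m) =
        ∑ m ∈ s, (φ m * mFourier m t) • X.translation m := by
      intro s
      induction s using Finset.induction_on with
      | empty => simp [conj]
      | insert a s ha ih =>
        rw [Finset.sum_insert ha, Finset.sum_insert ha, conj_add, ih, conj_smul,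
          conj_translation, smul_smul]
    exact (hsum φ.support).symm
  · rw [laurentPolynomial, Finsupp.onFinset_sum _ (by simp)]
    refine Finset.sum_congr rfl fun n _ => ?_
    simp only [laurentMonomial_rotate]
    ring

/-- Rotating z amounts to conjugating the convolution operator, which costs a factor `modBound ^ 2`.
Applied to all convolution powers of φ, the estimate loses this factor. -/
theorem rotate_mem_jointSpectrum (X : BanachSequenceSpace k E) {z : Fin k → ℂ}
    (hz : z ∈ X.jointSpectrum) (t : UnitAddTorus (Fin k)) : rotate z t ∈ X.jointSpectrum := by
  have hz' := rotate_ne_zero hz.1 t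
  refine ⟨hz', fun φ => ?_⟩
  let p : AddMonoidAlgebra ℂ (Fin k → ℤ) := .ofCoeff φ
  refine le_of_forall_pow_le_mul_pow (C := X.modBound ^ 2) (norm_nonneg _) fun N => ?_
  obtain ⟨ρ, hρ, hρz⟩ := X.exists_convOp_eq_conj (p ^ N).coeff t
  calc ‖laurentPolynomial φ (rotate z t)‖ ^ N = ‖evalHom hz' (p ^ N)‖ := by
        rw [map_pow, norm_pow, evalHom_apply]
    _ = ‖laurentPolynomial ρ z‖ := by rw [hρz, evalHom_apply]
    _ ≤ ‖X.convOp ρ‖ := hz.2 ρ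
    _ ≤ X.modBound ^ 2 * ‖X.convHom (p ^ N)‖ := by
        rw [hρ, convHom_apply]
        exact X.norm_conj_le t _
    _ ≤ X.modBound ^ 2 * ‖X.convOp φ‖ ^ N := by
        rw [map_pow, convHom_apply]
        have := X.nontrivial
        gcongr
        exact norm_pow_le _ _

/-! ### Convergence and spectral inclusion at interior points. -/

namespace IsMultiplier

variable {X : BanachSequenceSpace k E} {M : E →L[ℂ] E}

theorem norm_coeff_mul_laurentMonomial_le (hM : X.IsMultiplier M) {z : Fin k → ℂ}
    (hz : z ∈ X.jointSpectrum) (n : Fin k → ℤ) :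
    ‖X.coeff M n * laurentMonomial z n‖ ≤ X.modBound ^ 2 * ‖M‖ := by
  refine le_trans ?_ (hM.norm_coeff_smul_translation_le n)
  rw [← laurentPolynomial_single, ← convOp_single]
  exact hz.2 _

theorem summable_of_mem_interior (hM : X.IsMultiplier M) {z : Fin k → ℂ}
    (hz : z ∈ interior X.jointSpectrum) :
    Summable fun n => X.coeff M n * laurentMonomial z n := by
  have hcont : Continuous fun δ : Fin k → ℝ => fun i => z i * (Real.exp (δ i) : ℂ) := by fun_prop
  have hnhds : (fun δ : Fin k → ℝ => fun i => z i * (Real.exp (δ i) : ℂ)) ⁻¹' X.jointSpectrum ∈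
      𝓝 (0 : Fin k → ℝ) :=
    hcont.continuousAt.preimage_mem_nhds (by simpa using mem_interior_iff_mem_nhds.1 hz)
  obtain ⟨ε, hε, hball⟩ := Metric.nhds_basis_closedBall.mem_iff.1 hnhds
  have hr : Real.exp (-ε) < 1 := by simpa using hε
  refine Summable.of_norm_bounded
    ((summable_prod_pow_natAbs (k := k) (Real.exp_pos (-ε)).le hr).mul_left
      (X.modBound ^ 2 * ‖M‖)) fun n => ?_
  -- Each |zᵢ| is moved in the direction of the sign of nᵢ, which multiplies |zⁿ| by exp(ε ∑ |nᵢ|).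
  -- The uniform bound at the moved point then gives geometric decay at z.
  let δ : Fin k → ℝ := fun i => ε * (SignType.sign (n i) : ℝ)
  have hδ : δ ∈ Metric.closedBall (0 : Fin k → ℝ) ε := by
    rw [mem_closedBall_zero_iff, pi_norm_le_iff_of_nonneg hε.le]
    intro i
    simp only [δ, norm_mul, Real.norm_eq_abs, abs_of_pos hε]
    refine mul_le_of_le_one_right hε.le ?_
    rcases lt_trichotomy (n i) 0 with h | h | h <;> simp [h]
  have hmem := hM.norm_coeff_mul_laurentMonomial_le (hball hδ) n
  have hmon : ‖laurentMonomial (fun i => z i * (Real.exp (δ i) : ℂ)) n‖ *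
      ∏ i, Real.exp (-ε) ^ (n i).natAbs = ‖laurentMonomial z n‖ := by
    simp only [laurentMonomial, norm_prod, mul_zpow, norm_mul, norm_zpow]
    rw [← Finset.prod_mul_distrib]
    refine Finset.prod_congr rfl fun i _ => ?_
    rw [Complex.norm_real, Real.norm_eq_abs, Real.abs_exp, ← Real.rpow_intCast (Real.exp (δ i)),
      ← Real.exp_mul, ← Real.exp_nat_mul,
      mul_assoc, ← Real.exp_add]
    have : δ i * (n i : ℝ) + ((n i).natAbs : ℝ) * -ε = 0 := by
      have habs : ((n i).natAbs : ℝ) = |(n i : ℝ)| := by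
        rw [Nat.cast_natAbs, Int.cast_abs]
      rw [habs]
      simp only [δ]
      rcases lt_trichotomy (n i) 0 with h | h | h
      · have h' : (n i : ℝ) < 0 := by exact_mod_cast h
        simp only [sign_neg h, abs_of_neg h', SignType.coe_neg_one]
        ring
      · simp [h]
      · have h' : 0 < (n i : ℝ) := by exact_mod_cast h
        simp only [sign_pos h, abs_of_pos h', SignType.coe_one]
        ring
    rw [this, Real.exp_zero, mul_one]
  rw [norm_mul, ← hmon, ← mul_assoc, ← norm_mul]
  gcongr

theorem symbol_mem_spectrum (hM : X.IsMultiplier M) {z : Fin k → ℂ}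
    (hz : z ∈ interior X.jointSpectrum) : X.symbol M z ∈ spectrum ℂ M := by
  set c := X.symbol M z
  intro hunit
  rw [spectrum.mem_resolventSet_iff, Algebra.algebraMap_eq_smul_one] at hunit
  obtain ⟨R, hR1, hR2⟩ := isUnit_iff_exists.1 hunit
  have hM' := hM.sub_smul_one c
  have hR := hM'.of_mul_eq_one hR1 hR2
  have hz0 := (interior_subset hz).1
  have hone : ∀ a : ℂ, HasSum (fun n => X.coeff (a • 1) n * laurentMonomial z n) a := by
    intro a
    convert! hasSum_ite_eq (0 : Fin k → ℤ) a using 2 with n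
    rw [coeff_smul_one]
    split_ifs with h
    · rw [h, laurentMonomial_zero, mul_one]
    · exact zero_mul _
  have hzero : X.symbol (c • 1 - M) z = 0 := by
    have h := (hone c).sub (hM.summable_of_mem_interior hz).hasSum
    have h' : HasSum (fun n => X.coeff (c • 1 - M) n * laurentMonomial z n) (c - c) := by
      convert! h using 2 with n
      rw [coeff_sub, sub_mul]
    rw [symbol, h'.tsum_eq, sub_self]
  have h := hM'.hasSum_coeff_mul hz0 (hM'.summable_of_mem_interior hz)
    (hR.summable_of_mem_interior hz)
  rw [hR1, hzero, zero_mul] at h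
  have h1 := hone 1
  rw [one_smul] at h1
  exact one_ne_zero (h1.unique h)

end IsMultiplier

end BanachSequenceSpace

/-! ### Separation from a closed subspace; Fourier coefficients of Laurent polynomials. -/

theorem Submodule.exists_dual_ne_zero_of_notMem {V : Type*} [NormedAddCommGroup V]
    [NormedSpace ℂ V] {p : Submodule ℂ V} (hp : IsClosed (p : Set V)) {x : V} (hx : x ∉ p) :
    ∃ f : V →L[ℂ] ℂ, (∀ y ∈ p, f y = 0) ∧ f x ≠ 0 := by
  -- Closedness, available as an instance, makes the quotient seminorm a norm, so functionals
  -- separate points of the quotient.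
  have := hp
  have hx' : p.mkQL x ≠ 0 := by
    rwa [Submodule.mkQL_apply, Submodule.mkQ_apply, Ne, Submodule.Quotient.mk_eq_zero]
  obtain ⟨f, hf⟩ := SeparatingDual.exists_ne_zero (R := ℂ) hx'
  refine ⟨f.comp p.mkQL, fun y hy => ?_, hf⟩
  have : p.mkQL y = 0 := by
    rwa [Submodule.mkQL_apply, Submodule.mkQ_apply, Submodule.Quotient.mk_eq_zero]
  rw [ContinuousLinearMap.comp_apply, this, map_zero]

theorem laurentPolynomial_add {k : ℕ} (φ ρ : (Fin k → ℤ) →₀ ℂ) (z : Fin k → ℂ) :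
    laurentPolynomial (φ + ρ) z = laurentPolynomial φ z + laurentPolynomial ρ z :=
  Finsupp.sum_add_index' (fun _ => zero_mul _) fun _ _ _ => add_mul _ _ _

theorem continuousOn_laurentPolynomial {k : ℕ} (φ : (Fin k → ℤ) →₀ ℂ) :
    ContinuousOn (laurentPolynomial φ) {z | ∀ i, z i ≠ 0} := by
  unfold laurentPolynomial Finsupp.sum laurentMonomial
  refine continuousOn_finsetSum _ fun n _ => continuousOn_const.mul ?_
  refine continuousOn_finsetProd _ fun i _ => ?_
  exact (continuous_apply i).continuousOn.zpow₀ _ fun z hz => Or.inl (hz i)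

theorem continuous_laurentPolynomial_rotate {k : ℕ} (φ : (Fin k → ℤ) →₀ ℂ) {z : Fin k → ℂ}
    (hz : ∀ i, z i ≠ 0) : Continuous fun t => laurentPolynomial φ (rotate z t) :=
  (continuousOn_laurentPolynomial φ).comp_continuous (continuous_rotate z) (rotate_ne_zero hz)

theorem mFourierCoeff_laurentPolynomial_rotate {k : ℕ} (φ : (Fin k → ℤ) →₀ ℂ) {z : Fin k → ℂ}
    (hz : ∀ i, z i ≠ 0) (n : Fin k → ℤ) :
    mFourierCoeff (fun t => laurentPolynomial φ (rotate z t)) n =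
      φ n * laurentMonomial z n := by
  induction φ using Finsupp.induction_linear with
  | zero => simp [laurentPolynomial, mFourierCoeff]
  | add φ ρ hφ hρ =>
    simp only [laurentPolynomial_add]
    rw [mFourierCoeff_add (continuous_laurentPolynomial_rotate φ hz)
      (continuous_laurentPolynomial_rotate ρ hz), hφ, hρ, Finsupp.add_apply, add_mul]
  | single m c =>
    simp only [laurentPolynomial_single, laurentMonomial_rotate, ← mul_assoc]
    rw [mFourierCoeff_const_mul_mFourier, Finsupp.single_apply]
    by_cases h : n = m
    · simp [h]
    · simp [h, Ne.symm h]

/-! ### The convolution algebra and its inverse closedness. -/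

namespace BanachSequenceSpace

variable {k : ℕ} {E : Type*} [NormedAddCommGroup E] [NormedSpace ℂ E] [CompleteSpace E]

theorem range_convOp (X : BanachSequenceSpace k E) :
    Set.range X.convOp = (X.convHom.range : Set (E →L[ℂ] E)) := by
  ext T
  constructor
  · rintro ⟨φ, rfl⟩
    exact ⟨.ofCoeff φ, X.convHom_apply _⟩
  · rintro ⟨p, rfl⟩
    exact ⟨p.coeff, (X.convHom_apply p).symm⟩

theorem convAlgebra_eq (X : BanachSequenceSpace k E) :
    X.convAlgebra = X.convHom.range.topologicalClosure := by
  rw [convAlgebra, range_convOp, Algebra.adjoin_eq]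

theorem mem_convAlgebra_iff (X : BanachSequenceSpace k E) {M : E →L[ℂ] E} :
    M ∈ X.convAlgebra ↔ M ∈ closure (Set.range X.convOp) := by
  rw [convAlgebra_eq, range_convOp]
  rfl

theorem convOp_mem_convAlgebra (X : BanachSequenceSpace k E) (φ : (Fin k → ℤ) →₀ ℂ) :
    X.convOp φ ∈ X.convAlgebra :=
  X.mem_convAlgebra_iff.2 (subset_closure ⟨φ, rfl⟩)

theorem translation_mem_convAlgebra (X : BanachSequenceSpace k E) (m : Fin k → ℤ) :
    X.translation m ∈ X.convAlgebra := by
  have := X.convOp_mem_convAlgebra (Finsupp.single m 1)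
  rwa [convOp_single, one_smul] at this

theorem exists_tendsto_convOp (X : BanachSequenceSpace k E) {M : E →L[ℂ] E}
    (hM : M ∈ X.convAlgebra) :
    ∃ φ : ℕ → ((Fin k → ℤ) →₀ ℂ), Tendsto (fun j => X.convOp (φ j)) atTop (𝓝 M) := by
  obtain ⟨u, hu, hlim⟩ := mem_closure_iff_seq_limit.1 (X.mem_convAlgebra_iff.1 hM)
  choose φ hφ using hu
  exact ⟨φ, by simpa only [hφ] using hlim⟩

theorem convHom_range_comm (X : BanachSequenceSpace k E) (a b : X.convHom.range) :
    a * b = b * a := by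
  obtain ⟨_, p, rfl⟩ := a
  obtain ⟨_, q, rfl⟩ := b
  apply Subtype.ext
  change X.convHom p * X.convHom q = X.convHom q * X.convHom p
  rw [← map_mul, mul_comm, map_mul]

theorem convAlgebra_comm (X : BanachSequenceSpace k E) (a b : X.convAlgebra) :
    a * b = b * a := by
  let _ := X.convHom.range.commRingTopologicalClosure X.convHom_range_comm
  have h : ∀ a b : X.convHom.range.topologicalClosure, a * b = b * a := mul_comm
  rw [← convAlgebra_eq] at h
  exact h a b

theorem isMultiplier_of_mem_convAlgebra (X : BanachSequenceSpace k E) {M : E →L[ℂ] E}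
    (hM : M ∈ X.convAlgebra) : X.IsMultiplier M := fun m =>
  congrArg Subtype.val (X.convAlgebra_comm ⟨M, hM⟩ ⟨_, X.translation_mem_convAlgebra m⟩)

theorem continuous_conj_convOp (X : BanachSequenceSpace k E) (φ : (Fin k → ℤ) →₀ ℂ) :
    Continuous fun t => X.conj t (X.convOp φ) := by
  induction φ using Finsupp.induction_linear with
  | zero => simpa [convOp, conj] using continuous_const
  | add φ ρ hφ hρ =>
    have : X.convOp (φ + ρ) = X.convOp φ + X.convOp ρ :=
      Finsupp.sum_add_index' (fun _ => zero_smul _ _) fun _ _ _ => add_smul _ _ _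
    simp only [this, conj_add]
    exact hφ.add hρ
  | single m c =>
    simp only [convOp_single, conj_smul, conj_translation]
    fun_prop

theorem continuous_conj_of_mem_convAlgebra (X : BanachSequenceSpace k E) {M : E →L[ℂ] E}
    (hM : M ∈ X.convAlgebra) : Continuous fun t => X.conj t M := by
  refine continuous_of_mem_closure (f := fun t T => X.conj t T) (C := X.modBound ^ 2)
    (fun t S T => ?_) (fun T hT => ?_) (X.mem_convAlgebra_iff.1 hM)
  · rw [← conj_sub]
    exact X.norm_conj_le t _
  · obtain ⟨φ, rfl⟩ := hT
    exact X.continuous_conj_convOp φ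

/-- A multiplier on which the torus acts norm continuously is a norm limit of finite
convolutions. -/
theorem IsMultiplier.mem_convAlgebra {X : BanachSequenceSpace k E} {R : E →L[ℂ] E}
    (hR : X.IsMultiplier R) (hcont : Continuous fun t => X.conj t R) : R ∈ X.convAlgebra := by
  by_contra hRA
  -- A functional f vanishing on the algebra kills every translation, hence every Fourier
  -- coefficient of t ↦ f(`conj t R`), hence its value f(R) at t = 0.
  obtain ⟨f, hf, hfR⟩ := Submodule.exists_dual_ne_zero_of_notMem
    (p := Subalgebra.toSubmodule X.convAlgebra)
    (Subalgebra.isClosed_topologicalClosure _) (x := R) hRA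
  refine hfR ?_
  have h0 := apply_zero_eq_zero_of_mFourierCoeff_eq_zero (f.continuous.comp hcont) fun n => ?_
  · simpa [conj_zero] using h0
  have hcoeff : mFourierCoeff (fun t => X.conj t R) n = X.coeff R n • X.translation n := by
    ext x
    have := mFourierCoeff_clm_comp (ContinuousLinearMap.apply ℂ E x) hcont n
    simp only [ContinuousLinearMap.apply_apply] at this
    rw [← this, hR.mFourierCoeff_conj_apply]
    rfl
  have h1 := mFourierCoeff_clm_comp f hcont n
  rw [hcoeff, map_smul, hf _ (X.translation_mem_convAlgebra n), smul_zero] at h1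
  exact h1

/-- The algebra generated by the finite convolutions is inverse closed. -/
theorem inverse_mem_convAlgebra (X : BanachSequenceSpace k E) {M R : E →L[ℂ] E}
    (hM : M ∈ X.convAlgebra) (h1 : M * R = 1) (h2 : R * M = 1) : R ∈ X.convAlgebra := by
  refine ((X.isMultiplier_of_mem_convAlgebra hM).of_mul_eq_one h1 h2).mem_convAlgebra ?_
  -- Conjugation is multiplicative, so the orbit of R is the pointwise inverse of the norm
  -- continuous orbit of M, and inversion is continuous at units.
  let u : UnitAddTorus (Fin k) → (E →L[ℂ] E)ˣ := fun t =>
    ⟨X.conj t M, X.conj t R, by rw [← conj_mul, h1, conj_one], by rw [← conj_mul, h2, conj_one]⟩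
  have hu : (fun t => X.conj t R) = fun t => Ring.inverse (X.conj t M) := by
    funext t
    exact (Ring.inverse_unit (u t)).symm
  rw [hu, continuous_iff_continuousAt]
  intro t
  exact ContinuousAt.comp (g := Ring.inverse) (f := fun t => X.conj t M)
    (NormedRing.inverse_continuousAt (u t))
    (X.continuous_conj_of_mem_convAlgebra hM).continuousAt

/-! ### The Gelfand transform and the spectrum. -/

/-- `g` is, on the joint spectrum, the Gelfand transform of `M`. -/
def IsGelfandTransform (X : BanachSequenceSpace k E) (M : E →L[ℂ] E)
    (g : (Fin k → ℂ) → ℂ) : Prop :=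
  ∀ z ∈ X.jointSpectrum, ∀ φ : (Fin k → ℤ) →₀ ℂ,
    ‖laurentPolynomial φ z - g z‖ ≤ ‖X.convOp φ - M‖

theorem norm_laurentPolynomial_sub_le (X : BanachSequenceSpace k E) {z : Fin k → ℂ}
    (hz : z ∈ X.jointSpectrum) (φ ρ : (Fin k → ℤ) →₀ ℂ) :
    ‖laurentPolynomial φ z - laurentPolynomial ρ z‖ ≤ ‖X.convOp φ - X.convOp ρ‖ := by
  rw [← laurentPolynomial_sub, ← convOp_sub]
  exact hz.2 _

/-- Evaluation at z is norm decreasing on finite convolutions, so it extends to their limits; the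
defining inequality is the limit of the one between two Laurent polynomials. -/
theorem exists_isGelfandTransform (X : BanachSequenceSpace k E) {M : E →L[ℂ] E}
    (hM : M ∈ X.convAlgebra) : ∃ g, X.IsGelfandTransform M g := by
  obtain ⟨φ, hφ⟩ := X.exists_tendsto_convOp hM
  have hlim : ∀ z, ∃ w, z ∈ X.jointSpectrum →
      Tendsto (fun j => laurentPolynomial (φ j) z) atTop (𝓝 w) := by
    intro z
    by_cases hz : z ∈ X.jointSpectrum
    · have hcauchy : CauchySeq fun j => laurentPolynomial (φ j) z := by
        refine Metric.cauchySeq_iff.2 fun ε hε => ?_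
        obtain ⟨N, hN⟩ := Metric.cauchySeq_iff.1 hφ.cauchySeq ε hε
        refine ⟨N, fun i hi j hj => lt_of_le_of_lt ?_ (hN i hi j hj)⟩
        rw [dist_eq_norm, dist_eq_norm]
        exact X.norm_laurentPolynomial_sub_le hz _ _
      obtain ⟨w, hw⟩ := cauchySeq_tendsto_of_complete hcauchy
      exact ⟨w, fun _ => hw⟩
    · exact ⟨0, fun h => absurd h hz⟩
  choose g hg using hlim
  exact ⟨g, fun z hz ρ => le_of_tendsto_of_tendsto' ((hg z hz).const_sub _).norm
    (hφ.const_sub _).norm fun j => X.norm_laurentPolynomial_sub_le hz _ _⟩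

namespace IsGelfandTransform

variable {X : BanachSequenceSpace k E} {M : E →L[ℂ] E} {g : (Fin k → ℂ) → ℂ}

theorem tendstoUniformlyOn (hg : X.IsGelfandTransform M g) {φ : ℕ → ((Fin k → ℤ) →₀ ℂ)}
    (hφ : Tendsto (fun j => X.convOp (φ j)) atTop (𝓝 M)) :
    TendstoUniformlyOn (fun j => laurentPolynomial (φ j)) g atTop X.jointSpectrum := by
  refine Metric.tendstoUniformlyOn_iff.2 fun ε hε => ?_
  filter_upwards [Metric.tendsto_nhds.1 hφ ε hε] with j hj z hz
  rw [dist_comm, dist_eq_norm]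
  rw [dist_eq_norm] at hj
  exact (hg z hz _).trans_lt hj

theorem isContinuousSymbol (hM : M ∈ X.convAlgebra) (hg : X.IsGelfandTransform M g) :
    X.IsContinuousSymbol M g := by
  obtain ⟨φ, hφ⟩ := X.exists_tendsto_convOp hM
  have hcont : ContinuousOn g X.jointSpectrum :=
    (hg.tendstoUniformlyOn hφ).continuousOn (Frequently.of_forall fun j =>
      (continuousOn_laurentPolynomial (φ j)).mono fun z hz => hz.1)
  refine ⟨hcont, fun z hz n => ?_⟩
  change mFourierCoeff (fun t => g (rotate z t)) n = _
  have hgc : Continuous fun t => g (rotate z t) :=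
    hcont.comp_continuous (continuous_rotate z) (X.rotate_mem_jointSpectrum hz)
  have h1 : Tendsto (fun j => φ j n * laurentMonomial z n) atTop
      (𝓝 (mFourierCoeff (fun t => g (rotate z t)) n)) := by
    rw [tendsto_iff_norm_sub_tendsto_zero]
    refine squeeze_zero (fun _ => norm_nonneg _) (fun j => ?_)
      (tendsto_iff_norm_sub_tendsto_zero.1 hφ)
    rw [← mFourierCoeff_laurentPolynomial_rotate (φ j) hz.1,
      ← mFourierCoeff_sub (continuous_laurentPolynomial_rotate (φ j) hz.1) hgc]
    exact norm_mFourierCoeff_le (fun t => hg _ (X.rotate_mem_jointSpectrum hz t) _) n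
  have h2 : Tendsto (fun j => φ j n * laurentMonomial z n) atTop
      (𝓝 (X.coeff M n * laurentMonomial z n)) := by
    refine Tendsto.mul_const _ ?_
    have h3 := ((X.coord n).continuous.comp
      (ContinuousLinearMap.apply ℂ E X.unitSeq).continuous).tendsto M |>.comp hφ
    refine Tendsto.congr (fun j => ?_) h3
    exact X.coeff_convOp (φ j) n
  exact tendsto_nhds_unique h1 h2

theorem image_subset_spectrum (hM : M ∈ X.convAlgebra) (hg : X.IsGelfandTransform M g) :
    g '' X.jointSpectrum ⊆ spectrum ℂ M := by
  rintro _ ⟨z, hz, rfl⟩ hunit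
  rw [spectrum.mem_resolventSet_iff, Algebra.algebraMap_eq_smul_one] at hunit
  obtain ⟨R, hR1, hR2⟩ := isUnit_iff_exists.1 hunit
  have hR : R ∈ X.convAlgebra := X.inverse_mem_convAlgebra
    (Subalgebra.sub_mem _ (Subalgebra.smul_mem _ (Subalgebra.one_mem _) _) hM) hR1 hR2
  obtain ⟨φ, hφ⟩ := X.exists_tendsto_convOp hM
  obtain ⟨ρ, hρ⟩ := X.exists_tendsto_convOp hR
  obtain ⟨r, hr⟩ := X.exists_isGelfandTransform hR
  -- These elements approximate (g z - M)R - 1 = 0, yet their values at z tend to (g z - g z) r z -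
  -- 1 = -1.
  let p : ℕ → AddMonoidAlgebra ℂ (Fin k → ℤ) := fun j =>
    (g z • 1 - .ofCoeff (φ j)) * .ofCoeff (ρ j) - 1
  have h1 : Tendsto (fun j => X.convHom (p j)) atTop (𝓝 0) := by
    have h := ((hφ.const_sub (g z • 1)).mul hρ).sub_const 1
    rw [hR1, sub_self] at h
    refine h.congr fun j => ?_
    simp only [p, map_sub, map_mul, map_one, map_smul, convHom_apply]
  have h2 : Tendsto (fun j => evalHom hz.1 (p j)) atTop (𝓝 0) :=
    squeeze_zero_norm (fun j => X.norm_evalHom_le hz (p j)) (by simpa using h1.norm)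
  have h3 : Tendsto (fun j => evalHom hz.1 (p j)) atTop (𝓝 ((g z - g z) * r z - 1)) := by
    have h := ((((hg.tendstoUniformlyOn hφ).tendsto_at hz).const_sub (g z)).mul
      ((hr.tendstoUniformlyOn hρ).tendsto_at hz)).sub_const 1
    refine h.congr fun j => ?_
    simp only [p, map_sub, map_mul, map_one, map_smul, evalHom_apply, smul_eq_mul, mul_one]
  have := tendsto_nhds_unique h2 h3
  simp at this

theorem spectrum_subset_image (hM : M ∈ X.convAlgebra) (hg : X.IsGelfandTransform M g) :
    spectrum ℂ M ⊆ g '' X.jointSpectrum := by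
  intro c hc
  let _ : NormedCommRing X.convAlgebra :=
    { (inferInstance : NormedRing X.convAlgebra) with mul_comm := X.convAlgebra_comm }
  have : CompleteSpace X.convAlgebra :=
    (Subalgebra.isClosed_topologicalClosure _).completeSpace_coe
  have := X.nontrivial
  have hone : NormOneClass X.convAlgebra := ⟨norm_one (α := E →L[ℂ] E)⟩
  have hnot : ¬ IsUnit (algebraMap ℂ X.convAlgebra c - ⟨M, hM⟩) := by
    intro h
    exact hc (h.map X.convAlgebra.val)
  -- In a commutative Banach algebra a non-invertible element is killed by some character; the point
  -- z is read off from its values on the unit translations.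
  obtain ⟨χ, hχ⟩ := WeakDual.CharacterSpace.exists_apply_eq_zero hnot
  have hχM : χ ⟨M, hM⟩ = c := by
    rw [map_sub, AlgHomClass.commutes, sub_eq_zero] at hχ
    exact hχ.symm
  let τ : (Fin k → ℤ) → X.convAlgebra := fun m =>
    ⟨X.translation m, X.translation_mem_convAlgebra m⟩
  have hτ0 : τ 0 = 1 := Subtype.ext X.translation_zero
  have hτadd : ∀ m n, τ (m + n) = τ m * τ n := fun m n => Subtype.ext (X.translation_add m n)
  let μ : Multiplicative (Fin k → ℤ) →* ℂ :=
    { toFun := fun m => χ (τ m.toAdd)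
      map_one' := by rw [toAdd_one, hτ0, map_one]
      map_mul' := fun m n => by rw [toAdd_mul, hτadd, map_mul] }
  let z : Fin k → ℂ := fun i => χ (τ (Pi.single i 1))
  have hz0 : ∀ i, z i ≠ 0 := by
    intro i h
    have h1 : χ (τ (Pi.single i 1)) * χ (τ (-Pi.single i 1)) = 1 := by
      rw [← map_mul, ← hτadd, add_neg_cancel, hτ0, map_one]
    rw [show χ (τ (Pi.single i 1)) = 0 from h, zero_mul] at h1
    exact zero_ne_one h1
  have hμ : ∀ m, χ (τ m) = laurentMonomial z m := by
    intro m
    have hm : m = ∑ i, m i • Pi.single i (1 : ℤ) := by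
      funext j
      simp [Finset.sum_apply, Pi.single_apply]
    change μ (.ofAdd m) = _
    conv_lhs => rw [hm]
    rw [ofAdd_sum, map_prod]
    refine Finset.prod_congr rfl fun i _ => ?_
    have hpow : ∀ a : ℤ, μ (.ofAdd (a • Pi.single i (1 : ℤ))) = z i ^ a := by
      intro a
      rw [ofAdd_zsmul, ← μ.coe_toHomUnits, map_zpow, Units.val_zpow_eq_zpow_val, μ.coe_toHomUnits]
      rfl
    exact hpow (m i)
  have hval : ∀ φ, χ ⟨X.convOp φ, X.convOp_mem_convAlgebra φ⟩ = laurentPolynomial φ z := by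
    intro φ
    have : (⟨X.convOp φ, X.convOp_mem_convAlgebra φ⟩ : X.convAlgebra) =
        ∑ m ∈ φ.support, φ m • τ m := by
      apply Subtype.ext
      simp [convOp, Finsupp.sum, τ]
    rw [this, map_sum]
    refine Finset.sum_congr rfl fun m _ => ?_
    rw [map_smul, hμ, smul_eq_mul]
  have hz : z ∈ X.jointSpectrum := by
    refine ⟨hz0, fun φ => ?_⟩
    rw [← hval]
    exact AlgHom.norm_apply_le_self χ _
  refine ⟨z, hz, ?_⟩
  obtain ⟨φ, hφ⟩ := X.exists_tendsto_convOp hM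
  rw [← hχM]
  refine tendsto_nhds_unique ((hg.tendstoUniformlyOn hφ).tendsto_at hz) ?_
  rw [tendsto_iff_norm_sub_tendsto_zero]
  refine squeeze_zero (fun _ => norm_nonneg _) (fun j => ?_)
    (tendsto_iff_norm_sub_tendsto_zero.1 hφ)
  rw [← hval, ← map_sub]
  exact AlgHom.norm_apply_le_self χ _

end IsGelfandTransform

/-! ### Uniqueness of the continuous symbol and agreement with the series. -/

namespace IsContinuousSymbol

variable {X : BanachSequenceSpace k E} {M : E →L[ℂ] E} {g h : (Fin k → ℂ) → ℂ}

theorem continuous_rotate (hg : X.IsContinuousSymbol M g) {z : Fin k → ℂ}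
    (hz : z ∈ X.jointSpectrum) : Continuous fun t => g (rotate z t) :=
  hg.1.comp_continuous (_root_.continuous_rotate z) (X.rotate_mem_jointSpectrum hz)

theorem eqOn (hg : X.IsContinuousSymbol M g) (hh : X.IsContinuousSymbol M h) :
    Set.EqOn g h X.jointSpectrum := by
  intro z hz
  have hcont : Continuous fun t => g (rotate z t) - h (rotate z t) :=
    (hg.continuous_rotate hz).sub (hh.continuous_rotate hz)
  have h0 := apply_zero_eq_zero_of_mFourierCoeff_eq_zero hcont fun n => by
      rw [mFourierCoeff_sub (hg.continuous_rotate hz) (hh.continuous_rotate hz), sub_eq_zero]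
      exact (hg.2 z hz n).trans (hh.2 z hz n).symm
  simpa [rotate_zero, sub_eq_zero] using h0

theorem eq_symbol (hg : X.IsContinuousSymbol M g) {z : Fin k → ℂ} (hz : z ∈ X.jointSpectrum)
    (hs : Summable fun n => X.coeff M n * laurentMonomial z n) : g z = X.symbol M z := by
  have hcoeff : mFourierCoeff (fun t => g (rotate z t)) =
      fun n => X.coeff M n * laurentMonomial z n := funext (hg.2 z hz)
  have h := hasSum_mFourierCoeff (hg.continuous_rotate hz) (hcoeff ▸ hs)
  rw [hcoeff, rotate_zero] at h
  exact h.tsum_eq.symm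

end IsContinuousSymbol

end BanachSequenceSpace

end

theorem theorem7 {k : ℕ} {E : Type*} [NormedAddCommGroup E] [NormedSpace ℂ E] [CompleteSpace E]
    (X : BanachSequenceSpace k E) :
    (∀ M : E →L[ℂ] E, X.IsMultiplier M →
      (∀ z ∈ interior X.jointSpectrum,
        Summable fun n : Fin k → ℤ => X.coeff M n * laurentMonomial z n) ∧
      closure (X.symbol M '' interior X.jointSpectrum) ⊆ spectrum ℂ M) ∧
    (∀ M ∈ X.convAlgebra,
      (∃ g : (Fin k → ℂ) → ℂ, X.IsContinuousSymbol M g) ∧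
      ∀ g : (Fin k → ℂ) → ℂ, X.IsContinuousSymbol M g →
        (∀ z ∈ X.jointSpectrum,
          (Summable fun n : Fin k → ℤ => X.coeff M n * laurentMonomial z n) →
            g z = X.symbol M z) ∧
        (∀ φ : ℕ → ((Fin k → ℤ) →₀ ℂ),
          Tendsto (fun j => X.convOp (φ j)) atTop (𝓝 M) →
            TendstoUniformlyOn (fun j => laurentPolynomial (φ j)) g atTop X.jointSpectrum) ∧
        g '' X.jointSpectrum = spectrum ℂ M) := by
  refine ⟨fun M hM => ⟨fun z hz => hM.summable_of_mem_interior hz, ?_⟩, fun M hM => ?_⟩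
  · refine closure_minimal ?_ (spectrum.isClosed M)
    rintro _ ⟨z, hz, rfl⟩
    exact hM.symbol_mem_spectrum hz
  · obtain ⟨g₀, hg₀⟩ := X.exists_isGelfandTransform hM
    have hs₀ := hg₀.isContinuousSymbol hM
    refine ⟨⟨g₀, hs₀⟩, fun g hg => ?_⟩
    have heq := hg.eqOn hs₀
    refine ⟨fun z hz hs => hg.eq_symbol hz hs, fun φ hφ => ?_, ?_⟩
    · exact (hg₀.tendstoUniformlyOn hφ).congr_right heq.symm
    · rw [heq.image_eq]
      exact (hg₀.image_subset_spectrum hM).antisymm (hg₀.spectrum_subset_image hM)
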